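/- Let $n\ge 2$ and $L\ge 0$, let $P$ be the permutation matrix on $\mathbb C^n\otimes\mathbb C^n$ and $R(u)=\frac{u+iP}{u+i}$. Boundary data are triples $b=(l,\xi_-,\xi_+)$ with $l\in\{1,\dots,n-1\}$ and $\xi_\mp\in\mathbb C$. Put $$K^-_{(l)}(u,\xi_-)=\mathrm{diag}(\underbrace{i\xi_--u,\dots}_{l},\underbrace{i\xi_-+u,\dots}_{n-l}),\qquad K^+_{(l)}(u,\xi_+)=\mathrm{diag}(\underbrace{i\xi_++u,\dots}_{l},\underbrace{i(\xi_+-n)-u,\dots}_{n-l}),$$ and on $(\mathbb C^n)^{\otimes L}$ let $T_0(u)=R_{0L}(u)\cdots R_{01}(u)$, $\hat T_0(u)=R_{10}(u)\cdots R_{L0}(u)$ and $$t_{(l)}(u,\xi_\mp)=\mathrm{tr}_0\,K^+_{(l)\,0}(u,\xi_+)\,T_0(u)\,K^-_{(l)\,0}(u,\xi_-)\,\hat T_0(u).$$ **Bethe Ansatz equations.** An implementation of the algebraic Bethe Ansatz for an operator function $t(u)$ on $(\mathbb C^n)^{\otimes L}$ with a pseudovacuum $\Omega\neq0$ consists of $m\in\{1,\dots,n-1\}$,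 $\zeta\in\mathbb C$, and an $n\times n$ matrix $\mathcal T(u)$ of operators on $(\mathbb C^n)^{\otimes L}$, meromorphic in $u$, such that $$R_{12}(u-v)\,\mathcal T_1(u)\,R_{21}(u+v)\,\mathcal T_2(v)=\mathcal T_2(v)\,R_{12}(u+v)\,\mathcal T_1(u)\,R_{21}(u-v),\qquad t(u)=\mathrm{tr}_0\,K^+_{(m)\,0}(u,\zeta)\,\mathcal T_0(u),$$ $\mathcal T_{jk}(u)\Omega=0$ for $j>k$, and $\mathcal T_{jj}(u)\Omega=\delta_j(u)\Omega$. Let $\kappa_1,\dots,\kappa_n$ be the diagonal entries of $K^+_{(m)}(u,\zeta)$. For Bethe roots $\{\lambda^{(k)}_\alpha\}$ ($1\le k\le n-1$, $1\le\alpha\le M^{(k)}$) put $Q_k(x)=\prod_\alpha(x-\lambda^{(k)}_\alpha)(x+\lambda^{(k)}_\alpha)$ and $Q_0=Q_n=1$. The transfer-matrix eigenvalue given by the nested Bethe Ansatz is $$\Lambda(u)=\sum_{k=1}^n\Big(\kappa_k+\tfrac{i}{2u+ki}\sum_{p>k}\kappa_p\Big)\Big(\delta_k-\tfrac{i}{2u+(k-1)i}\sum_{p<k}\delta_p\Big)\frac{Q_{k-1}(u+\frac{(k+1)i}2)}{Q_{k-1}(u+\frac{(k-1)i}2)}\,\frac{Q_k(u+\frac{(k-2)i}2)}{Q_k(u+\frac{ki}2)}.$$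 The Bethe Ansatz equations (BAE) of the implementation are the conditions on the roots that $\Lambda$ has zero residue at $u=\lambda^{(k)}_\alpha-\frac{ki}2$ for all $k,\alpha$. A system of equations for the roots (for all choices of the numbers $M^{(k)}$) is called a system of BAE for $t$ with pseudovacuum $\Omega$ if it has the same solutions as the BAE of some implementation for $(t,\Omega)$. With $\omega_{(1)}=e_1^{\otimes L}$, the matrix $\mathcal T=T K^-_{(l)}\hat T$ together with $K^+_{(l)}(u,\xi_+)$ is an implementation for $(t_{(l)}(\cdot,\xi_\mp),\omega_{(1)})$, called the standard one. **Lemma.** Let $D$ be a set of boundary data and $g:D\to D$, $(l,\xi_\mp)\mapsto(l',\xi'_\mp)$, a map with $g^2=1$. For each $b=(l,\xi_\mp)\in D$ let $\mathcal U_b$ be a unitary operator on $(\mathbb C^n)^{\otimes L}$, and let $\omega,\omega'$ be vectors, such that for all $b\in D$ $$\mathcal U_b\,t_{(l)}(u,\xi_\mp)\,\mathcal U_b^\dagger=t_{(l')}(u,\xi'_\mp)\ \text{ for all } u,\qquad \mathcal U_b\,\omega=\omega'.$$ Then for every $(l,\xi_\mp)\in D$ the BAE for $t_{(l)}(u,\xi_\mp)$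 with the pseudovacuum $\omega'$ are the same as the BAE for $t_{(l')}(u,\xi'_\mp)$ with the pseudovacuum $\omega$: a system of equations is a system of BAE for the former if and only if it is one for the latter. In particular, if $\omega=\omega_{(1)}$, then the standard BAE for $(l',\xi'_\mp)$ are BAE for $t_{(l)}(u,\xi_\mp)$ with the pseudovacuum $\omega'$. -/

import Mathlib

open Matrix Filter Topology

namespace OpenChain

/-! ### The quantum space, the `R` matrix and the transfer matrix

`n` is the dimension of the one-site space `ℂⁿ` and `L` is the number of sites. The quantum space
`(ℂⁿ)^{⊗L}` is described in its standard product basis, indexed by `Fin L → Fin n`; basis labels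
`1, …, n` are shifted to `0, …, n-1`. -/

/-- Vectors of the quantum space. -/
abbrev State (n L : ℕ) := (Fin L → Fin n) → ℂ

/-- Operators on the quantum space. -/
abbrev Op (n L : ℕ) := Matrix (Fin L → Fin n) (Fin L → Fin n) ℂ

/-- Matrices in the auxiliary space whose entries are operators on the quantum space. -/
abbrev AuxOp (n L : ℕ) := Matrix (Fin n) (Fin n) (Op n L)

/-- The boundary data `(l, ξ₋, ξ₊)`, with `l ∈ {1, …, n-1}`. -/
@[ext]
structure BoundaryData (n : ℕ) where
  l : ℕ
  one_le : 1 ≤ l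
  lt : l < n
  xiMinus : ℂ
  xiPlus : ℂ

/-- The permutation matrix `x ⊗ y ↦ y ⊗ x`. -/
def permMatrix (n : ℕ) : Matrix (Fin n × Fin n) (Fin n × Fin n) ℂ :=
  Matrix.of fun p q => if p.1 = q.2 ∧ p.2 = q.1 then 1 else 0

/-- `R(u) = (u + i P) / (u + i)`. -/
noncomputable def rMatrix (n : ℕ) (u : ℂ) : Matrix (Fin n × Fin n) (Fin n × Fin n) ℂ :=
  (u + Complex.I)⁻¹ • (u • 1 + Complex.I • permMatrix n)

/-- The tensor product `F₁ ⊗ ⋯ ⊗ F_L`. -/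
def tensorOp {n L : ℕ} (F : Fin L → Matrix (Fin n) (Fin n) ℂ) : Op n L :=
  Matrix.of fun x y => ∏ j, F j (x j) (y j)

/-- `1 ⊗ ⋯ ⊗ A ⊗ ⋯ ⊗ 1`, with `A` at site `k`. -/
def siteOp {n L : ℕ} (k : Fin L) (A : Matrix (Fin n) (Fin n) ℂ) : Op n L :=
  tensorOp (Function.update 1 k A)

/-- `R_{0k}(u)` as a matrix in the auxiliary space `0`. -/
noncomputable def rAux {n L : ℕ} (k : Fin L) (u : ℂ) : AuxOp n L :=
  Matrix.of fun a b => siteOp k (Matrix.of fun c d => rMatrix n u (a, c) (b, d))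

/-- `R_{k0}(u)` as a matrix in the auxiliary space `0`. -/
noncomputable def rAux' {n L : ℕ} (k : Fin L) (u : ℂ) : AuxOp n L :=
  Matrix.of fun a b => siteOp k (Matrix.of fun c d => rMatrix n u (c, a) (d, b))

/-- `T₀(u) = R_{0L}(u) ⋯ R_{01}(u)`. -/
noncomputable def monodromy (n L : ℕ) (u : ℂ) : AuxOp n L :=
  (List.ofFn fun k : Fin L => rAux k u).reverse.prod

/-- `T̂₀(u) = R_{10}(u) ⋯ R_{L0}(u)`. -/
noncomputable def monodromyHat (n L : ℕ) (u : ℂ) : AuxOp n L :=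
  (List.ofFn fun k : Fin L => rAux' k u).prod

/-- Diagonal entries of `K⁻_{(l)}(u, ξ)`: `iξ - u` (`l` times), then `iξ + u`. -/
noncomputable def kMinus {n : ℕ} (l : ℕ) (xi : ℂ) (j : Fin n) (u : ℂ) : ℂ :=
  if (j : ℕ) < l then Complex.I * xi - u else Complex.I * xi + u

/-- Diagonal entries of `K⁺_{(l)}(u, ξ)`: `iξ + u` (`l` times), then `i(ξ - n) - u`. -/
noncomputable def kPlus {n : ℕ} (l : ℕ) (xi : ℂ) (j : Fin n) (u : ℂ) : ℂ :=
  if (j : ℕ) < l then Complex.I * xi + u else Complex.I * (xi - n) - u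

/-- A diagonal matrix acting in the auxiliary space only. -/
def auxDiag {n : ℕ} (L : ℕ) (d : Fin n → ℂ) : AuxOp n L :=
  Matrix.diagonal fun j => d j • (1 : Op n L)

/-- The double-row monodromy matrix `T₀(u) K⁻(u) T̂₀(u)`. -/
noncomputable def doubleRow {n : ℕ} (L : ℕ) (b : BoundaryData n) (u : ℂ) : AuxOp n L :=
  monodromy n L u * auxDiag L (fun j => kMinus b.l b.xiMinus j u) * monodromyHat n L u

/-- The transfer matrix `t_{(l)}(u, ξ∓) = tr₀ K⁺₀(u) T₀(u) K⁻₀(u) T̂₀(u)`. -/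
noncomputable def transfer {n : ℕ} (L : ℕ) (b : BoundaryData n) (u : ℂ) : Op n L :=
  Matrix.trace (auxDiag L (fun j => kPlus b.l b.xiPlus j u) * doubleRow L b u)

/-- The pseudovacuum `ω_(k) = e_k ⊗ ⋯ ⊗ e_k`, with `k` counted from `1`. -/
def pseudovacuum (n L : ℕ) (k : ℕ) : State n L :=
  fun x => if ∀ i, (x i : ℕ) + 1 = k then 1 else 0

/-! ### The nested algebraic Bethe Ansatz -/

/-- `A ⊗ 1` on two copies of the auxiliary space. -/
def leg1 {n L : ℕ} (A : AuxOp n L) : Matrix (Fin n × Fin n) (Fin n × Fin n) (Op n L) :=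
  Matrix.of fun p q => if p.2 = q.2 then A p.1 q.1 else 0

/-- `1 ⊗ A` on two copies of the auxiliary space. -/
def leg2 {n L : ℕ} (A : AuxOp n L) : Matrix (Fin n × Fin n) (Fin n × Fin n) (Op n L) :=
  Matrix.of fun p q => if p.1 = q.1 then A p.2 q.2 else 0

/-- `R₁₂(u)` on two copies of the auxiliary space (it equals `R₂₁(u)`). -/
noncomputable def rTwo (n L : ℕ) (u : ℂ) : Matrix (Fin n × Fin n) (Fin n × Fin n) (Op n L) :=
  (rMatrix n u).map fun c => c • (1 : Op n L)

/-- An implementation of the algebraic Bethe Ansatz for the transfer matrix `t` on the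
pseudovacuum `Ω`: an operator-valued matrix obeying the boundary Yang-Baxter equation (the
reflection algebra), from which `t` is obtained by tracing with one of the matrices `K⁺`, and
for which `Ω` is a highest-weight vector. The entries of the matrix above the diagonal are the
creation operators, those below it annihilate `Ω`, the diagonal ones have `Ω` as eigenvector. -/
structure BetheAnsatz {n L : ℕ} (t : ℂ → Op n L) (Ω : State n L) where
  /-- The parameters of `K⁺`. -/
  l : ℕ
  one_le : 1 ≤ l
  lt : l < n
  xiPlus : ℂ
  /-- The double-row monodromy matrix. -/
  mono : ℂ → AuxOp n L
  meromorphic : ∀ j k x y, Meromorphic fun u => mono u j k x y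
  reflection : ∀ u v : ℂ,
    rTwo n L (u - v) * leg1 (mono u) * rTwo n L (u + v) * leg2 (mono v) =
      leg2 (mono v) * rTwo n L (u + v) * leg1 (mono u) * rTwo n L (u - v)
  trace_eq : ∀ u, t u = Matrix.trace (auxDiag L (fun j => kPlus l xiPlus j u) * mono u)
  /-- The vacuum eigenvalues. -/
  vac : Fin n → ℂ → ℂ
  vacuum_ne : Ω ≠ 0
  vacuum_lower : ∀ u j k, k < j → mono u j k *ᵥ Ω = 0
  vacuum_diag : ∀ u j, mono u j j *ᵥ Ω = vac j u • Ω

/-- Bethe roots: `M^{(k)}` numbers `λ^{(k)}_α` at each level `k = 1, …, n-1`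
(level `k` has index `k - 1`). -/
abbrev Roots (n : ℕ) (M : Fin (n - 1) → ℕ) := (k : Fin (n - 1)) → Fin (M k) → ℂ

/-- `Q_m(x) = ∏_α (x - λ^{(m)}_α)(x + λ^{(m)}_α)` for the levels `1 ≤ m ≤ n-1`;
`Q_0 = Q_n = 1`. -/
noncomputable def Q {n : ℕ} {M : Fin (n - 1) → ℕ} (v : Roots n M) (m : ℕ) (x : ℂ) : ℂ :=
  if h : 0 < m ∧ m - 1 < n - 1 then
    ∏ α, (x - v ⟨m - 1, h.2⟩ α) * (x + v ⟨m - 1, h.2⟩ α)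
  else 1

/-- The transfer-matrix eigenvalue produced by the nested algebraic Bethe Ansatz: with vacuum
eigenvalues `δ_1, …, δ_n` and diagonal entries `κ_1, …, κ_n` of `K⁺`, it is the sum over
`k = 1, …, n` of
`(κ_k + i/(2u+ki) ∑_{p>k} κ_p) (δ_k - i/(2u+(k-1)i) ∑_{p<k} δ_p)
  Q_{k-1}(u+(k+1)i/2)/Q_{k-1}(u+(k-1)i/2) Q_k(u+(k-2)i/2)/Q_k(u+ki/2)`.
Below `j = k - 1`. -/
noncomputable def betheEigenvalue {n : ℕ} (κ δ : Fin n → ℂ → ℂ) {M : Fin (n - 1) → ℕ}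
    (v : Roots n M) (u : ℂ) : ℂ :=
  ∑ j : Fin n,
    (κ j u + Complex.I / (2 * u + ((j : ℕ) + 1) * Complex.I) * ∑ p ∈ Finset.Ioi j, κ p u) *
    (δ j u - Complex.I / (2 * u + (j : ℕ) * Complex.I) * ∑ p ∈ Finset.Iio j, δ p u) *
    (Q v j (u + (j : ℕ) * Complex.I / 2 + Complex.I) / Q v j (u + (j : ℕ) * Complex.I / 2)) *
    (Q v (j + 1) (u + ((j : ℕ) + 1) * Complex.I / 2 - Complex.I) /
      Q v (j + 1) (u + ((j : ℕ) + 1) * Complex.I / 2))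

/-- `f` has residue `c` at `p`: `(2πi)⁻¹ ∮ f = c` over all small circles around `p`. -/
def HasResidueAt (f : ℂ → ℂ) (p c : ℂ) : Prop :=
  ∀ᶠ r in 𝓝[>] (0 : ℝ), (2 * Real.pi * Complex.I)⁻¹ * (∮ z in C(p, r), f z) = c

/-- The eigenvalue, as a function of the Bethe roots and the spectral parameter. -/
noncomputable def BetheAnsatz.eigenvalue {n L : ℕ} {t : ℂ → Op n L} {Ω : State n L}
    (A : BetheAnsatz t Ω) {M : Fin (n - 1) → ℕ} (v : Roots n M) (u : ℂ) : ℂ :=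
  betheEigenvalue (kPlus A.l A.xiPlus) A.vac v u

/-- The Bethe Ansatz equations of an implementation, for root numbers `M`: for every root
`λ^{(k)}_α` the residue of the eigenvalue at `u = λ^{(k)}_α - ki/2` vanishes. -/
def BetheAnsatz.SolvesBAE {n L : ℕ} {t : ℂ → Op n L} {Ω : State n L}
    (A : BetheAnsatz t Ω) {M : Fin (n - 1) → ℕ} (v : Roots n M) : Prop :=
  ∀ (k : Fin (n - 1)) (α : Fin (M k)),
    HasResidueAt (A.eigenvalue v) (v k α - ((k : ℕ) + 1) * Complex.I / 2) 0

/-- `E` is a system of Bethe Ansatz equations (one for each choice of the root numbers) for the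
transfer matrix `t` with the pseudovacuum `Ω`. -/
def IsBAE {n L : ℕ} (t : ℂ → Op n L) (Ω : State n L)
    (E : (M : Fin (n - 1) → ℕ) → Roots n M → Prop) : Prop :=
  ∃ A : BetheAnsatz t Ω, ∀ M v, E M v ↔ A.SolvesBAE v

/-! ### The double-row monodromy matrix implements the Bethe Ansatz on `ω_(1)` -/

section proofs
variable {n L : ℕ}

theorem tensorOp_mul (F G : Fin L → Matrix (Fin n) (Fin n) ℂ) :
    tensorOp F * tensorOp G = tensorOp (fun j => F j * G j) := by
  ext x y
  simp only [tensorOp, Matrix.mul_apply, Matrix.of_apply, ← Finset.prod_mul_distrib]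
  rw [Finset.prod_univ_sum]
  simp

theorem siteOp_apply (k : Fin L) (A : Matrix (Fin n) (Fin n) ℂ) (x y) :
    siteOp k A x y = A (x k) (y k) *
      ∏ j ∈ Finset.univ.erase k, (1 : Matrix (Fin n) (Fin n) ℂ) (x j) (y j) := by
  simp only [siteOp, tensorOp, Matrix.of_apply]
  rw [← Finset.mul_prod_erase _ _ (Finset.mem_univ k)]
  congr 1
  · simp
  · refine Finset.prod_congr rfl fun j hj => ?_
    rw [Function.update_of_ne (Finset.ne_of_mem_erase hj)]; rfl

theorem siteOp_add (k : Fin L) (A B : Matrix (Fin n) (Fin n) ℂ) :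
    siteOp k (A + B) = siteOp k A + siteOp k B := by
  ext x y; simp [siteOp_apply, add_mul]

theorem siteOp_smul (k : Fin L) (c : ℂ) (A : Matrix (Fin n) (Fin n) ℂ) :
    siteOp k (c • A) = c • siteOp k A := by
  ext x y; simp [siteOp_apply, mul_assoc]

theorem siteOp_zero (k : Fin L) : siteOp k (0 : Matrix (Fin n) (Fin n) ℂ) = 0 := by
  ext x y; simp [siteOp_apply]

theorem siteOp_one (k : Fin L) : siteOp k (1 : Matrix (Fin n) (Fin n) ℂ) = 1 := by
  ext x y
  have : Function.update (1 : Fin L → Matrix (Fin n) (Fin n) ℂ) k 1 = 1 :=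
    Function.update_eq_self k _
  simp only [siteOp, this, tensorOp, Matrix.of_apply, Pi.one_apply, Matrix.one_apply]
  rw [Finset.prod_ite_zero]
  simp [funext_iff]

theorem siteOp_mul (k : Fin L) (A B : Matrix (Fin n) (Fin n) ℂ) :
    siteOp k A * siteOp k B = siteOp k (A * B) := by
  rw [siteOp, siteOp, tensorOp_mul, siteOp]
  congr 1; funext j
  by_cases h : j = k
  · subst h; simp
  · simp [Function.update_of_ne h]

theorem siteOp_comm {k k' : Fin L} (h : k ≠ k') (A B : Matrix (Fin n) (Fin n) ℂ) :
    Commute (siteOp k A) (siteOp k' B) := by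
  unfold Commute SemiconjBy
  rw [siteOp, siteOp, tensorOp_mul, tensorOp_mul]
  congr 1; funext j
  by_cases h1 : j = k
  · subst h1; simp [Function.update_of_ne h]
  · simp [Function.update_of_ne h1]

/-- The site permutation `P_{0k}` as a matrix in the auxiliary space. -/
def permAux (k : Fin L) : AuxOp n L :=
  Matrix.of fun a b => siteOp k (Matrix.single b a 1)

theorem rAux_eq (k : Fin L) (u : ℂ) : (rAux k u : AuxOp n L) =
    (u + Complex.I)⁻¹ • (u • 1 + Complex.I • permAux k) := by
  refine Matrix.ext fun a b => ?_
  have : (Matrix.of fun c d => rMatrix n u (a, c) (b, d)) =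
      (u + Complex.I)⁻¹ • (u • (if a = b then (1 : Matrix (Fin n) (Fin n) ℂ) else 0)
        + Complex.I • Matrix.single b a 1) := by
    ext c d
    by_cases h : a = b <;>
    simp [rMatrix, permMatrix, Matrix.one_apply, Matrix.single_apply, h, eq_comm, and_comm]
  simp only [rAux, Matrix.of_apply, this, siteOp_smul, siteOp_add, permAux, Matrix.smul_apply,
    Matrix.add_apply]
  by_cases h : a = b
  · subst h; simp [siteOp_one]
  · simp [h, siteOp_zero]

theorem rAux'_eq (k : Fin L) (u : ℂ) : (rAux' k u : AuxOp n L) = rAux k u := by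
  refine Matrix.ext fun a b => ?_
  simp only [rAux, rAux', Matrix.of_apply]
  congr 1; ext c d
  simp [rMatrix, permMatrix, Matrix.one_apply, and_comm]

theorem permAux_mul (k : Fin L) (a b c d : Fin n) :
    (permAux k : AuxOp n L) a b * permAux k c d = if a = d then permAux k c b else 0 := by
  simp only [permAux, Matrix.of_apply, siteOp_mul]
  by_cases h : a = d
  · subst h; simp
  · simp [h, siteOp_zero, Matrix.single_mul_single_of_ne _ _ _ _ h]

/-- `P₁₂` on two copies of the auxiliary space. -/
def permTwo (n L : ℕ) : Matrix (Fin n × Fin n) (Fin n × Fin n) (Op n L) :=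
  Matrix.of fun p q => if p.1 = q.2 ∧ p.2 = q.1 then 1 else 0

theorem rTwo_eq (u : ℂ) : rTwo n L u =
    (u + Complex.I)⁻¹ • (u • 1 + Complex.I • permTwo n L) := by
  refine Matrix.ext fun p q => ?_
  simp only [rTwo, rMatrix, permMatrix, permTwo, Matrix.map_apply, Matrix.smul_apply,
    Matrix.add_apply, Matrix.of_apply, Matrix.one_apply, smul_eq_mul]
  split_ifs <;> module

theorem permTwo_mul (X : Matrix (Fin n × Fin n) (Fin n × Fin n) (Op n L)) (p q) :
    (permTwo n L * X) p q = X p.swap q := by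
  rw [Matrix.mul_apply, Finset.sum_eq_single p.swap]
  · simp [permTwo]
  · intro r _ hr
    have : ¬ (p.1 = r.2 ∧ p.2 = r.1) := fun h => hr (Prod.ext h.2.symm h.1.symm)
    simp [permTwo, this]
  · simp

theorem mul_permTwo (X : Matrix (Fin n × Fin n) (Fin n × Fin n) (Op n L)) (p q) :
    (X * permTwo n L) p q = X p q.swap := by
  rw [Matrix.mul_apply, Finset.sum_eq_single q.swap]
  · simp [permTwo]
  · intro r _ hr
    have : ¬ (r.1 = q.2 ∧ r.2 = q.1) := fun h => hr (Prod.ext h.1 h.2)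
    simp [permTwo, this]
  · simp

theorem permTwo_sq : permTwo n L * permTwo n L = 1 := by
  refine Matrix.ext fun p q => ?_
  rw [permTwo_mul]
  simp [permTwo, Matrix.one_apply, Prod.ext_iff, and_comm]

theorem permTwo_leg1 (A : AuxOp n L) : permTwo n L * leg1 A = leg2 A * permTwo n L := by
  refine Matrix.ext fun p q => ?_
  rw [permTwo_mul, mul_permTwo]; simp [leg1, leg2]

theorem permTwo_leg2 (A : AuxOp n L) : permTwo n L * leg2 A = leg1 A * permTwo n L := by
  refine Matrix.ext fun p q => ?_
  rw [permTwo_mul, mul_permTwo]; simp [leg1, leg2]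

theorem leg1_mul_apply (A : AuxOp n L) (X : Matrix (Fin n × Fin n) (Fin n × Fin n) (Op n L))
    (p q) : (leg1 A * X) p q = ∑ a, A p.1 a * X (a, p.2) q := by
  rw [Matrix.mul_apply, Fintype.sum_prod_type]
  simp [leg1]

theorem leg2_mul_apply (A : AuxOp n L) (X : Matrix (Fin n × Fin n) (Fin n × Fin n) (Op n L))
    (p q) : (leg2 A * X) p q = ∑ a, A p.2 a * X (p.1, a) q := by
  rw [Matrix.mul_apply, Fintype.sum_prod_type]
  simp [leg2]

theorem leg1_mul (A B : AuxOp n L) : leg1 (A * B) = leg1 A * leg1 B := by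
  refine Matrix.ext fun p q => ?_
  rw [leg1_mul_apply]
  by_cases h : p.2 = q.2 <;> simp [leg1, Matrix.mul_apply, h]

theorem leg2_mul (A B : AuxOp n L) : leg2 (A * B) = leg2 A * leg2 B := by
  refine Matrix.ext fun p q => ?_
  rw [leg2_mul_apply]
  by_cases h : p.1 = q.1 <;> simp [leg2, Matrix.mul_apply, h]

theorem leg1_leg2_apply (A B : AuxOp n L) (p q) :
    (leg1 A * leg2 B) p q = A p.1 q.1 * B p.2 q.2 := by
  rw [leg1_mul_apply]; simp [leg2]

theorem leg2_leg1_apply (A B : AuxOp n L) (p q) :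
    (leg2 A * leg1 B) p q = A p.2 q.2 * B p.1 q.1 := by
  rw [leg2_mul_apply]; simp [leg1]

theorem leg_comm {A B : AuxOp n L} (h : ∀ a b c d, Commute (A a b) (B c d)) :
    leg1 A * leg2 B = leg2 B * leg1 A := by
  refine Matrix.ext fun p q => ?_
  rw [leg1_leg2_apply, leg2_leg1_apply]; exact h _ _ _ _

theorem leg1_lin (c u w : ℂ) (A : AuxOp n L) :
    leg1 (c • (u • 1 + w • A)) = c • (u • 1 + w • leg1 A) := by
  refine Matrix.ext fun p q => ?_
  by_cases h : p.2 = q.2 <;> by_cases h' : p.1 = q.1 <;>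
    simp [leg1, Matrix.one_apply, h, h', Prod.ext_iff]

theorem leg2_lin (c u w : ℂ) (A : AuxOp n L) :
    leg2 (c • (u • 1 + w • A)) = c • (u • 1 + w • leg2 A) := by
  refine Matrix.ext fun p q => ?_
  by_cases h : p.2 = q.2 <;> by_cases h' : p.1 = q.1 <;>
    simp [leg2, Matrix.one_apply, h, h', Prod.ext_iff]

theorem perm_rel1 (k : Fin L) : leg1 (permAux k : AuxOp n L) * leg2 (permAux k) =
    permTwo n L * leg1 (permAux k) := by
  refine Matrix.ext fun p q => ?_
  rw [leg1_leg2_apply, permTwo_mul, permAux_mul]; simp [leg1]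

theorem perm_rel2 (k : Fin L) : leg2 (permAux k : AuxOp n L) * leg1 (permAux k) =
    permTwo n L * leg2 (permAux k) := by
  refine Matrix.ext fun p q => ?_
  rw [leg2_leg1_apply, permTwo_mul, permAux_mul]; simp [leg2]

/-- The boundary Yang-Baxter equation. -/
def Reflection (X : ℂ → AuxOp n L) : Prop := ∀ u v : ℂ,
    rTwo n L (u - v) * leg1 (X u) * rTwo n L (u + v) * leg2 (X v) =
      leg2 (X v) * rTwo n L (u + v) * leg1 (X u) * rTwo n L (u - v)

theorem alg_smul3 {S : Type*} [Ring S] [Algebra ℂ S] (a b c : ℂ) (X Y Z : S) :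
    (a • X) * (b • Y) * (c • Z) = (a * b * c) • (X * Y * Z) := by
  simp only [smul_mul_assoc, mul_smul_comm, smul_smul]
  congr 1; ring

theorem alg_yb1 {S : Type*} [Ring S] [Algebra ℂ S] {E1 E2 P : S} (h1 : E1 * E2 = P * E1)
    (h2 : E2 * E1 = P * E2) (h3 : P * E1 = E2 * P) (h4 : P * E2 = E1 * P) (h5 : P * P = 1)
    (u v w : ℂ) :
    ((u - v) • 1 + w • P) * (u • 1 + w • E1) * (v • 1 + w • E2) =
      (v • 1 + w • E2) * (u • 1 + w • E1) * ((u - v) • 1 + w • P) := by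
  have h6 : P * E1 * E2 = E1 := by rw [mul_assoc, h1, ← mul_assoc, h5, one_mul]
  have h7 : E2 * E1 * P = E1 := by rw [h2, mul_assoc, ← h3, ← mul_assoc, h5, one_mul]
  simp only [mul_add, add_mul, smul_mul_assoc, mul_smul_comm, one_mul, mul_one, h6, h7]
  rw [h1, h2, ← h3, ← h4]
  module

theorem alg_yb2 {S : Type*} [Ring S] [Algebra ℂ S] {E1 E2 P : S} (h1 : E1 * E2 = P * E1)
    (h2 : E2 * E1 = P * E2) (h3 : P * E1 = E2 * P) (h4 : P * E2 = E1 * P)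
    (u v w : ℂ) :
    (u • 1 + w • E1) * ((u + v) • 1 + w • P) * (v • 1 + w • E2) =
      (v • 1 + w • E2) * ((u + v) • 1 + w • P) * (u • 1 + w • E1) := by
  have h8 : E1 * P * E2 = E2 * P * E1 := by
    have e1 : E1 * P * E2 = E2 * E1 * E2 := by rw [← h4, ← h2]
    have e2 : E2 * P * E1 = E2 * E1 * E2 := by rw [mul_assoc, ← h1, ← mul_assoc]
    rw [e1, e2]
  simp only [mul_add, add_mul, smul_mul_assoc, mul_smul_comm, one_mul, mul_one, h8]
  rw [h1, h2, ← h3, ← h4]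
  module

theorem alg_refl {S : Type*} [Ring S] [Algebra ℂ S] {P K K' J J' : S} {u v w : ℂ}
    (h3 : P * K = K' * P) (h4 : P * J' = J * P) (h5 : P * P = 1)
    (c1 : K * J' = J' * K) (c2 : K' * J' = J' * K')
    (hd : (u - v) • (K * J - J' * K') + (u + v) • (K' * J - J' * K) = 0) :
    ((u - v) • 1 + w • P) * K * ((u + v) • 1 + w • P) * J' =
      J' * ((u + v) • 1 + w • P) * K * ((u - v) • 1 + w • P) := by
  have a1 : K * P * J' = K * J * P := by rw [mul_assoc, h4, mul_assoc]
  have a2 : P * K * J' = K' * J * P := by rw [h3, mul_assoc, h4, mul_assoc]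
  have a3 : P * K * P * J' = J' * K' := by rw [h3, mul_assoc K', h5, mul_one, c2]
  have a4 : J' * P * K = J' * K' * P := by rw [mul_assoc, h3, mul_assoc]
  have a5 : J' * K' * P * P = J' * K' := by rw [mul_assoc, h5, mul_one]
  have hd' := congrArg (fun X => w • (X * P)) hd
  simp only [mul_add, add_mul, sub_mul, smul_mul_assoc, mul_smul_comm, one_mul, mul_one, zero_mul,
    smul_zero, a1, a2, a3, a4, a5, c1] at hd' ⊢
  rw [← sub_eq_zero] 
  refine Eq.trans ?_ hd'
  module

theorem alg_smul_refl {S : Type*} [Ring S] [Algebra ℂ S] {X Y K J : S} (a b : ℂ)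
    (h : X * K * Y * J = J * Y * K * X) :
    (a • X) * K * (b • Y) * J = J * (b • Y) * K * (a • X) := by
  simp only [smul_mul_assoc, mul_smul_comm, h, smul_smul]
  congr 1; ring

theorem yb1 (k : Fin L) (u v : ℂ) :
    rTwo n L (u - v) * leg1 (rAux k u) * leg2 (rAux k v) =
      leg2 (rAux k v) * leg1 (rAux k u) * rTwo n L (u - v) := by
  rw [rAux_eq, rAux_eq, leg1_lin, leg2_lin, rTwo_eq, alg_smul3, alg_smul3,
    alg_yb1 (perm_rel1 k) (perm_rel2 k) (permTwo_leg1 _) (permTwo_leg2 _) permTwo_sq]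
  congr 1; ring

theorem yb2 (k : Fin L) (u v : ℂ) :
    leg1 (rAux k u) * rTwo n L (u + v) * leg2 (rAux k v) =
      leg2 (rAux k v) * rTwo n L (u + v) * leg1 (rAux k u) := by
  rw [rAux_eq, rAux_eq, leg1_lin, leg2_lin, rTwo_eq, alg_smul3, alg_smul3,
    alg_yb2 (perm_rel1 k) (perm_rel2 k) (permTwo_leg1 _) (permTwo_leg2 _)]
  congr 1; ring

theorem Reflection.dress {X : ℂ → AuxOp n L} (hX : Reflection X) (k : Fin L)
    (hc : ∀ u v a b c d, Commute (X u a b) ((rAux k v : AuxOp n L) c d)) :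
    Reflection fun u => rAux k u * X u * rAux k u := by
  intro u v
  have c1 := leg_comm (hc u v)
  have c2 := leg_comm fun a b c d => (hc v u c d a b).symm
  have y1 := yb1 (n := n) k u v
  have y2 := yb2 (n := n) k u v
  have hX := hX u v
  simp only [leg1_mul, leg2_mul]
  generalize leg1 (rAux k u : AuxOp n L) = A at *
  generalize leg2 (rAux k v : AuxOp n L) = B at *
  generalize leg1 (X u) = Y at *
  generalize leg2 (X v) = Z at *
  generalize rTwo n L (u - v) = R at *
  generalize rTwo n L (u + v) = S at *
  calc R * (A * Y * A) * S * (B * Z * B) = R * A * Y * (A * S * B) * Z * B := by noncomm_ring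
    _ = R * A * (Y * B) * S * (A * Z) * B := by rw [y2]; noncomm_ring
    _ = (R * A * B) * Y * S * Z * A * B := by rw [c1, c2]; noncomm_ring
    _ = B * A * (R * Y * S * Z) * A * B := by rw [y1]; noncomm_ring
    _ = B * (A * Z) * S * Y * (R * A * B) := by rw [hX]; noncomm_ring
    _ = B * Z * A * S * (Y * B) * A * R := by rw [c2, y1]; noncomm_ring
    _ = B * Z * (A * S * B) * Y * A * R := by rw [c1]; noncomm_ring
    _ = B * Z * B * S * (A * Y * A) * R := by rw [y2]; noncomm_ring

theorem leg1_auxDiag (d : Fin n → ℂ) :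
    leg1 (auxDiag L d) = Matrix.diagonal fun p => d p.1 • (1 : Op n L) := by
  refine Matrix.ext fun p q => ?_
  by_cases h : p.2 = q.2 <;> by_cases h' : p.1 = q.1 <;>
    simp [leg1, auxDiag, Matrix.diagonal_apply, h, h', Prod.ext_iff]

theorem leg2_auxDiag (d : Fin n → ℂ) :
    leg2 (auxDiag L d) = Matrix.diagonal fun p => d p.2 • (1 : Op n L) := by
  refine Matrix.ext fun p q => ?_
  by_cases h : p.2 = q.2 <;> by_cases h' : p.1 = q.1 <;>
    simp [leg2, auxDiag, Matrix.diagonal_apply, h, h', Prod.ext_iff]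

theorem reflection_kMinus (l : ℕ) (xi : ℂ) :
    Reflection fun u => (auxDiag L fun j => kMinus l xi j u : AuxOp n L) := by
  intro u v
  rw [rTwo_eq, rTwo_eq]
  refine alg_smul_refl _ _ (alg_refl (K' := leg2 (auxDiag L fun j => kMinus l xi j u))
    (J := leg1 (auxDiag L fun j => kMinus l xi j v))
    (permTwo_leg1 _) (permTwo_leg2 _) permTwo_sq ?_ ?_ ?_)
  · simp only [leg1_auxDiag, leg2_auxDiag, Matrix.diagonal_mul_diagonal, smul_mul_smul_comm,
      mul_comm]
  · simp only [leg2_auxDiag, Matrix.diagonal_mul_diagonal, smul_mul_smul_comm, mul_comm]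
  · simp only [leg1_auxDiag, leg2_auxDiag, Matrix.diagonal_mul_diagonal, smul_mul_smul_comm,
      Matrix.diagonal_sub, mul_one]
    refine Matrix.ext fun p q => ?_
    by_cases h : p = q
    · subst h
      simp only [Matrix.add_apply, Matrix.smul_apply, Matrix.diagonal_apply_eq, ← sub_smul,
        smul_smul, ← add_smul, Matrix.zero_apply]
      convert zero_smul ℂ (1 : Op n L)
      unfold kMinus
      split_ifs <;> ring
    · simp [Matrix.diagonal_apply_ne _ h]

theorem pseudovacuum_one (z : Fin n) (hz : (z : ℕ) = 0) :
    pseudovacuum n L 1 = Pi.single (fun _ => z) 1 := by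
  funext x
  have : (∀ i, (x i : ℕ) + 1 = 1) ↔ x = fun _ => z := by
    simp [funext_iff, Fin.ext_iff, hz]
  simp only [pseudovacuum, this, Pi.single_apply]

theorem permAux_vac_ne (k : Fin L) (a b : Fin n) (ha : (a : ℕ) ≠ 0) :
    (permAux k a b : Op n L) *ᵥ pseudovacuum n L 1 = 0 := by
  rw [pseudovacuum_one ⟨0, by omega⟩ rfl, Matrix.mulVec_single_one]
  funext x
  have : a ≠ ⟨0, by omega⟩ := fun h => ha (by rw [h])
  simp [permAux, siteOp_apply, this]

theorem permAux_vac (k : Fin L) (z : Fin n) (hz : (z : ℕ) = 0) :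
    (permAux k z z : Op n L) *ᵥ pseudovacuum n L 1 = pseudovacuum n L 1 := by
  rw [pseudovacuum_one z hz, Matrix.mulVec_single_one]
  funext x
  simp only [permAux, Matrix.col_apply, Matrix.of_apply, siteOp_apply, Matrix.single_apply,
    Matrix.one_apply, Pi.single_apply]
  rw [Finset.prod_ite_zero]
  by_cases h : x = fun _ => z
  · simp [h]
  · rw [if_neg h]
    by_cases hk : z = x k
    · rw [if_neg (c := ∀ i ∈ _, _)]
      · simp
      · intro h'
        apply h; funext j
        by_cases hj : j = k
        · subst hj; exact hk.symm
        · exact h' j (by simp [hj])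
    · simp [hk]

theorem rAux_apply (k : Fin L) (u : ℂ) (a b : Fin n) : (rAux k u : AuxOp n L) a b =
    (u + Complex.I)⁻¹ • (u • (if a = b then 1 else 0) + Complex.I • permAux k a b) := by
  rw [rAux_eq]; simp [Matrix.one_apply]

theorem rAux_vac_ne (k : Fin L) (u : ℂ) (a b : Fin n) (ha : (a : ℕ) ≠ 0) :
    (rAux k u a b : Op n L) *ᵥ pseudovacuum n L 1 =
      ((u + Complex.I)⁻¹ * (if a = b then u else 0)) • pseudovacuum n L 1 := by
  rw [rAux_apply]
  simp only [Matrix.smul_mulVec, Matrix.add_mulVec, permAux_vac_ne k a b ha, smul_zero, add_zero]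
  split_ifs
  · rw [Matrix.one_mulVec, smul_smul]
  · simp

theorem rAux_vac_zero (k : Fin L) (u : ℂ) (z : Fin n) (hz : (z : ℕ) = 0) :
    (rAux k u z z : Op n L) *ᵥ pseudovacuum n L 1 =
      ((u + Complex.I)⁻¹ * (u + Complex.I)) • pseudovacuum n L 1 := by
  rw [rAux_apply]
  simp only [Matrix.smul_mulVec, Matrix.add_mulVec, permAux_vac k z hz, if_true,
    Matrix.one_mulVec]
  module

theorem rAux_vac_pair (k : Fin L) (u : ℂ) (z j m : Fin n) (hz : (z : ℕ) = 0)
    (hj : (j : ℕ) ≠ 0) (hjm : j ≠ m) :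
    (rAux k u j z * rAux k u z m : Op n L) *ᵥ pseudovacuum n L 1 = 0 := by
  have hjz : j ≠ z := fun h => hj (h ▸ hz)
  rw [rAux_apply, rAux_apply]
  simp only [if_neg hjz, smul_zero, zero_add, smul_mul_assoc, mul_smul_comm, mul_add,
    permAux_mul, if_neg hjm, add_zero, Matrix.smul_mulVec]
  by_cases h : z = m
  · simp [h, permAux_vac_ne k j _ hj]
  · simp [h]

theorem rAux_vac_pair' (k : Fin L) (u : ℂ) (z j : Fin n) (hz : (z : ℕ) = 0)
    (hj : (j : ℕ) ≠ 0) : ∃ c : ℂ,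
    (rAux k u j z * rAux k u z j : Op n L) *ᵥ pseudovacuum n L 1 = c • pseudovacuum n L 1 := by
  have hjz : j ≠ z := fun h => hj (h ▸ hz)
  rw [rAux_apply, rAux_apply]
  simp only [if_neg hjz, if_neg hjz.symm, smul_zero, zero_add, smul_mul_assoc, mul_smul_comm,
    permAux_mul, if_true, Matrix.smul_mulVec, permAux_vac k z hz, smul_smul]
  exact ⟨_, rfl⟩

/-- `pseudovacuum n L 1` is a highest-weight vector of `X`. -/
def VacProp (X : AuxOp n L) : Prop :=
  (∀ j k : Fin n, (j : ℕ) ≠ 0 → j ≠ k → X j k *ᵥ pseudovacuum n L 1 = 0) ∧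
  ∀ j, ∃ d : ℂ, X j j *ᵥ pseudovacuum n L 1 = d • pseudovacuum n L 1

theorem dress_apply_vac {X : AuxOp n L} (k : Fin L) (u : ℂ)
    (hc : ∀ a b c d, Commute (X a b) ((rAux k u : AuxOp n L) c d)) (j m : Fin n) :
    (rAux k u * X * rAux k u : AuxOp n L) j m *ᵥ pseudovacuum n L 1 =
      ∑ b, ∑ a, (rAux k u j a * rAux k u b m * X a b) *ᵥ pseudovacuum n L 1 := by
  simp only [Matrix.mul_apply, Finset.sum_mul, Matrix.sum_mulVec]
  refine Finset.sum_congr rfl fun b _ => Finset.sum_congr rfl fun a _ => ?_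
  rw [mul_assoc, (hc a b b m).eq, ← mul_assoc]

theorem dress_term {X : AuxOp n L} (hX : VacProp X) (k : Fin L) (u : ℂ)
    (hc : ∀ a b c d, Commute (X a b) ((rAux k u : AuxOp n L) c d)) (j m a b : Fin n)
    (h : (j : ℕ) ≠ 0 ∨ j = m) : ∃ c : ℂ, (j ≠ m → c = 0) ∧
      (rAux k u j a * rAux k u b m * X a b) *ᵥ pseudovacuum n L 1 =
        c • pseudovacuum n L 1 := by
  have hb : (b : ℕ) ≠ 0 → ∀ Y : Op n L, (Y * rAux k u b m) *ᵥ pseudovacuum n L 1 =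
      ((u + Complex.I)⁻¹ * (if b = m then u else 0)) • (Y *ᵥ pseudovacuum n L 1) := by
    intro hb Y
    rw [← Matrix.mulVec_mulVec, rAux_vac_ne k u b m hb, Matrix.mulVec_smul]
  by_cases hab : a = b
  · subst hab
    obtain ⟨d, hd⟩ := hX.2 a
    have key : ∃ c : ℂ, (j ≠ m → c = 0) ∧ (rAux k u j a * rAux k u a m : Op n L) *ᵥ
        pseudovacuum n L 1 = c • pseudovacuum n L 1 := by
      by_cases ha : (a : ℕ) = 0
      · by_cases hj : (j : ℕ) = 0
        · have hjm : j = m := by tauto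
          have hja : j = a := Fin.ext (hj.trans ha.symm)
          subst hjm; subst hja
          rw [← Matrix.mulVec_mulVec, rAux_vac_zero k u j hj, Matrix.mulVec_smul,
            rAux_vac_zero k u j hj, smul_smul]
          exact ⟨_, fun h => absurd rfl h, rfl⟩
        · by_cases hjm : j = m
          · subst hjm
            obtain ⟨c, hc⟩ := rAux_vac_pair' k u a j ha hj
            exact ⟨c, fun h => absurd rfl h, hc⟩
          · exact ⟨0, fun _ => rfl, by rw [rAux_vac_pair k u a j m ha hj hjm, zero_smul]⟩
      · rw [hb ha]
        by_cases ham : a = m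
        · subst ham
          by_cases hj : (j : ℕ) = 0
          · have hja : j = a := by tauto
            exact absurd (hja ▸ hj) ha
          · rw [rAux_vac_ne k u j a hj, smul_smul]
            refine ⟨_, fun hja => ?_, rfl⟩
            simp [hja]
        · exact ⟨0, fun _ => rfl, by simp [ham]⟩
    obtain ⟨c, hc0, hc⟩ := key
    refine ⟨d * c, fun h => by rw [hc0 h, mul_zero], ?_⟩
    rw [← Matrix.mulVec_mulVec, hd, Matrix.mulVec_smul, hc, smul_smul]
  · refine ⟨0, fun _ => rfl, ?_⟩
    rw [zero_smul]
    by_cases ha : (a : ℕ) = 0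
    · have hb0 : (b : ℕ) ≠ 0 := fun h' => hab (Fin.ext (ha.trans h'.symm))
      have comm : rAux k u j a * rAux k u b m * X a b = X a b * (rAux k u j a * rAux k u b m) :=
        ((hc a b j a).mul_right (hc a b b m)).eq.symm
      rw [comm, ← Matrix.mulVec_mulVec, hb hb0]
      by_cases hbm : b = m
      · subst hbm
        have hj : (j : ℕ) ≠ 0 := by
          rcases h with h | h
          · exact h
          · exact h ▸ hb0
        have hja : j ≠ a := fun h' => hj (h' ▸ ha)
        rw [rAux_vac_ne k u j a hj]
        simp [hja]
      · simp [hbm]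
    · rw [← Matrix.mulVec_mulVec, hX.1 a b ha hab, Matrix.mulVec_zero]

theorem VacProp.dress {X : AuxOp n L} (hX : VacProp X) (k : Fin L) (u : ℂ)
    (hc : ∀ a b c d, Commute (X a b) ((rAux k u : AuxOp n L) c d)) :
    VacProp (rAux k u * X * rAux k u) := by
  constructor
  · intro j m hj hjm
    rw [dress_apply_vac k u hc]
    refine Finset.sum_eq_zero fun b _ => Finset.sum_eq_zero fun a _ => ?_
    obtain ⟨c, h0, h1⟩ := dress_term hX k u hc j m a b (Or.inl hj)
    rw [h1, h0 hjm, zero_smul]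
  · intro j
    choose c _ h1 using fun b a => dress_term hX k u hc j j a b (Or.inr rfl)
    refine ⟨∑ b, ∑ a, c b a, ?_⟩
    rw [dress_apply_vac k u hc]
    simp only [h1, Finset.sum_smul]

theorem VacProp.diag (d : Fin n → ℂ) : VacProp (auxDiag L d) := by
  constructor
  · intro j k _ h; simp [auxDiag, h]
  · intro j; exact ⟨d j, by simp [auxDiag, Matrix.smul_mulVec]⟩

/-- All matrix entries depend meromorphically on the parameter. -/
def MeroProp (X : ℂ → AuxOp n L) : Prop := ∀ j k x y, Meromorphic fun u => X u j k x y

theorem MeroProp.mul {X Y : ℂ → AuxOp n L} (hX : MeroProp X) (hY : MeroProp Y) :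
    MeroProp fun u => X u * Y u := by
  intro j k x y
  simp only [Matrix.mul_apply, Matrix.sum_apply]
  intro p
  refine MeromorphicAt.fun_sum fun a _ => MeromorphicAt.fun_sum fun z _ => ?_
  exact (hX j a x z p).mul (hY a k z y p)

theorem meroProp_rAux (k : Fin L) : MeroProp fun u => (rAux k u : AuxOp n L) := by
  intro a b x y p
  simp only [rAux_apply, Matrix.smul_apply, Matrix.add_apply, smul_eq_mul]
  fun_prop

theorem meroProp_kMinus (l : ℕ) (xi : ℂ) :
    MeroProp fun u => (auxDiag L fun j => kMinus l xi j u : AuxOp n L) := by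
  intro a b x y p
  by_cases h : a = b
  · subst h
    by_cases h' : (a : ℕ) < l <;>
    · simp only [auxDiag, Matrix.diagonal_apply_eq, Matrix.smul_apply, smul_eq_mul, kMinus, h',
        if_true, if_false]
      fun_prop
  · simp only [auxDiag, Matrix.diagonal_apply_ne _ h, Matrix.zero_apply]
    fun_prop

/-- The double-row monodromy matrix built from the sites in a list. -/
noncomputable def rowOf (b : BoundaryData n) (ks : List (Fin L)) (u : ℂ) : AuxOp n L :=
  (ks.map fun k => rAux k u).reverse.prod * auxDiag L (fun j => kMinus b.l b.xiMinus j u) *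
    (ks.map fun k => rAux' k u).prod

theorem doubleRow_eq (b : BoundaryData n) : doubleRow L b = rowOf b (List.finRange L) := by
  funext u
  simp only [doubleRow, rowOf, monodromy, monodromyHat, List.ofFn_eq_map]

theorem rowOf_append (b : BoundaryData n) (ks : List (Fin L)) (k : Fin L) :
    rowOf b (ks ++ [k]) = fun u => rAux k u * rowOf b ks u * rAux k u := by
  funext u
  simp [rowOf, rAux'_eq, mul_assoc]

theorem rowOf_props (b : BoundaryData n) (ks : List (Fin L)) : ks.Nodup →
    Reflection (rowOf b ks) ∧ MeroProp (rowOf b ks) ∧ (∀ u, VacProp (rowOf b ks u)) ∧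
    ∀ k ∉ ks, ∀ u v a c d e, Commute (rowOf b ks u a c) ((rAux k v : AuxOp n L) d e) := by
  induction ks using List.reverseRecOn with
  | nil =>
    intro _
    have h : rowOf b ([] : List (Fin L)) =
        fun u => auxDiag L fun j => kMinus b.l b.xiMinus j u := by
      funext u; simp [rowOf]
    rw [h]
    refine ⟨reflection_kMinus _ _, meroProp_kMinus _ _, fun u => VacProp.diag _, ?_⟩
    intro k _ u v a c d e
    by_cases hac : a = c
    · subst hac
      simp only [auxDiag, Matrix.diagonal_apply_eq]
      exact (Commute.one_left _).smul_left _
    · simp only [auxDiag, Matrix.diagonal_apply_ne _ hac]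
      exact Commute.zero_left _
  | append_singleton ks k ih =>
    intro hnd
    rw [List.nodup_append] at hnd
    obtain ⟨h1, h2, h3, h4⟩ := ih hnd.1
    have hk : k ∉ ks := fun h => hnd.2.2 k h k (by simp) rfl
    rw [rowOf_append]
    refine ⟨h1.dress k fun u v => h4 k hk u v, ((meroProp_rAux k).mul h2).mul (meroProp_rAux k),
      fun u => (h3 u).dress k u (h4 k hk u u), ?_⟩
    intro k' hk' u v a c d e
    simp only [List.mem_append, List.mem_singleton, not_or] at hk'
    have hr : ∀ p q, Commute ((rAux k u : AuxOp n L) p q) ((rAux k' v : AuxOp n L) d e) :=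
      fun p q => siteOp_comm (Ne.symm hk'.2) _ _
    simp only [Matrix.mul_apply]
    refine Commute.sum_left _ _ _ fun p _ => (Commute.mul_left ?_ (hr _ _))
    exact Commute.sum_left _ _ _ fun q _ => (hr _ _).mul_left (h4 k' hk'.1 u v _ _ _ _)

end proofs

/-- The usual implementation: the transfer matrix `t_{(l)}(u, ξ∓)` with the pseudovacuum
`ω_(1)` and the double-row monodromy matrix `T₀(u) K⁻₀(u) T̂₀(u)`. The vacuum eigenvalues are
read off as matrix elements at `ω_(1)`. -/
noncomputable def standardAnsatz {n : ℕ} (L : ℕ) (b : BoundaryData n) :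
    BetheAnsatz (transfer L b) (pseudovacuum n L 1) where
  l := b.l
  one_le := b.one_le
  lt := b.lt
  xiPlus := b.xiPlus
  mono := doubleRow L b
  meromorphic := by
    rw [doubleRow_eq]; exact (rowOf_props b _ (List.nodup_finRange L)).2.1
  reflection := by
    rw [doubleRow_eq]; exact (rowOf_props b _ (List.nodup_finRange L)).1
  trace_eq := fun _ => rfl
  vac := fun j u => doubleRow L b u j j
    (fun _ => ⟨0, b.one_le.trans b.lt.le⟩) (fun _ => ⟨0, b.one_le.trans b.lt.le⟩)
  vacuum_ne := by
    rw [pseudovacuum_one ⟨0, b.one_le.trans b.lt.le⟩ rfl]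
    intro h
    simpa using congrFun h fun _ => ⟨0, b.one_le.trans b.lt.le⟩
  vacuum_lower := by
    intro u j k h
    rw [doubleRow_eq]
    refine ((rowOf_props b _ (List.nodup_finRange L)).2.2.1 u).1 j k ?_ h.ne'
    have := Fin.lt_def.1 h
    omega
  vacuum_diag := by
    intro u j
    obtain ⟨d, hd⟩ := ((rowOf_props b _ (List.nodup_finRange L)).2.2.1 u).2 j
    rw [← doubleRow_eq] at hd
    rw [hd]
    congr 1
    rw [pseudovacuum_one ⟨0, b.one_le.trans b.lt.le⟩ rfl, Matrix.mulVec_single_one] at hd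
    simpa using (congrFun hd fun _ => ⟨0, b.one_le.trans b.lt.le⟩).symm


end OpenChain

/-! Conjugation by an invertible `W` carries an implementation for `(t, Ω)` to one for
`(W t W⁻¹, W Ω)` with the same `K⁺` and the same vacuum eigenvalues, hence with literally the same
Bethe Ansatz equations. As `g² = 1`, the operator attached to `g b` conjugates `t` at `g b` back to
`t` at `b` while still mapping `ω` to `ω'`; this is why the two pseudovacua trade places. -/

namespace OpenChain

section AlgHom

variable {n L L' : ℕ}

theorem rTwo_map (φ : Op n L →ₐ[ℂ] Op n L') (u : ℂ) : (rTwo n L u).map φ = rTwo n L' u := by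
  ext1 p q
  simp only [rTwo, Matrix.map_apply, map_smul, map_one]

theorem leg1_map {f : Op n L → Op n L'} (hf : f 0 = 0) (A : AuxOp n L) :
    (leg1 A).map f = leg1 (A.map f) := by
  ext1 p q
  simp only [leg1, Matrix.map_apply, Matrix.of_apply, apply_ite f, hf]

theorem leg2_map {f : Op n L → Op n L'} (hf : f 0 = 0) (A : AuxOp n L) :
    (leg2 A).map f = leg2 (A.map f) := by
  ext1 p q
  simp only [leg2, Matrix.map_apply, Matrix.of_apply, apply_ite f, hf]

theorem Reflection.map {X : ℂ → AuxOp n L} (hX : Reflection X) (φ : Op n L →ₐ[ℂ] Op n L') :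
    Reflection fun u => (X u).map φ := by
  intro u v
  simpa only [Matrix.map_mul, rTwo_map, leg1_map (map_zero φ), leg2_map (map_zero φ)] using
    congrArg (fun Y => Y.map φ) (hX u v)

theorem MeroProp.map {X : ℂ → AuxOp n L} (hX : MeroProp X) (φ : Op n L →ₗ[ℂ] Op n L') :
    MeroProp fun u => (X u).map φ := by
  intro j k x y
  have entry_eq_sum (Y : Op n L) : φ Y x y = ∑ a, ∑ b, Y a b * φ (Matrix.single a b 1) x y := by
    have smul_single (a b) : Matrix.single a b (Y a b) = Y a b • Matrix.single a b (1 : ℂ) := by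
      rw [Matrix.smul_single, smul_eq_mul, mul_one]
    conv_lhs => rw [Matrix.matrix_eq_sum_single Y]
    simp only [smul_single, map_sum, map_smul, Matrix.sum_apply, Matrix.smul_apply, smul_eq_mul]
  change Meromorphic fun u => φ (X u j k) x y
  rw [funext fun u => entry_eq_sum (X u j k)]
  exact fun p => MeromorphicAt.fun_sum fun a _ => MeromorphicAt.fun_sum fun b _ =>
    (hX j k a b p).mul (MeromorphicAt.const _ p)

theorem trace_auxDiag_mul_map (φ : Op n L →ₗ[ℂ] Op n L') (d : Fin n → ℂ) (A : AuxOp n L) :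
    Matrix.trace (auxDiag L' d * A.map φ) = φ (Matrix.trace (auxDiag L d * A)) := by
  simp only [Matrix.trace, Matrix.diag_apply, auxDiag, Matrix.diagonal_mul, Matrix.map_apply,
    smul_mul_assoc, one_mul, map_sum, map_smul]

end AlgHom

section Transport

variable {n L L' : ℕ} {t : ℂ → Op n L} {Ω : State n L}

/-- Transport of an implementation along an algebra homomorphism `φ` and a map `V` of states that
intertwines the two actions, possibly between chains of different lengths. The parameters of `K⁺`
and the vacuum eigenvalues are kept. -/
noncomputable def BetheAnsatz.map (A : BetheAnsatz t Ω) (φ : Op n L →ₐ[ℂ] Op n L')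
    (V : State n L →ₗ[ℂ] State n L') (hV : ∀ X ψ, φ X *ᵥ V ψ = V (X *ᵥ ψ)) (hΩ : V Ω ≠ 0) :
    BetheAnsatz (fun u => φ (t u)) (V Ω) where
  l := A.l
  one_le := A.one_le
  lt := A.lt
  xiPlus := A.xiPlus
  mono u := (A.mono u).map φ
  meromorphic := MeroProp.map A.meromorphic φ.toLinearMap
  reflection := Reflection.map A.reflection φ
  trace_eq u := by
    rw [A.trace_eq]
    exact (trace_auxDiag_mul_map φ.toLinearMap _ _).symm
  vac := A.vac
  vacuum_ne := hΩ
  vacuum_lower u j k hkj := by rw [Matrix.map_apply, hV, A.vacuum_lower u j k hkj, map_zero]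
  vacuum_diag u j := by rw [Matrix.map_apply, hV, A.vacuum_diag, map_smul]

theorem BetheAnsatz.isBAE (A : BetheAnsatz t Ω) : IsBAE t Ω fun _ v => A.SolvesBAE v :=
  ⟨A, fun _ _ => Iff.rfl⟩

variable {E : (M : Fin (n - 1) → ℕ) → Roots n M → Prop}

theorem IsBAE.map (h : IsBAE t Ω E) (φ : Op n L →ₐ[ℂ] Op n L') (V : State n L →ₗ[ℂ] State n L')
    (hV : ∀ X ψ, φ X *ᵥ V ψ = V (X *ᵥ ψ)) (hΩ : V Ω ≠ 0) :
    IsBAE (fun u => φ (t u)) (V Ω) E := by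
  obtain ⟨A, hA⟩ := h
  exact ⟨A.map φ V hV hΩ, hA⟩

theorem IsBAE.conj (h : IsBAE t Ω E) (W : (Op n L)ˣ) :
    IsBAE (fun u => (W : Op n L) * t u * (↑W⁻¹ : Op n L)) ((W : Op n L) *ᵥ Ω) E := by
  have hΩ : (W : Op n L) *ᵥ Ω ≠ 0 := by
    obtain ⟨A, -⟩ := h
    simpa only [Matrix.mulVec_zero] using
      (Matrix.mulVec_injective_of_isUnit W.isUnit).ne A.vacuum_ne
  refine h.map (MulSemiringAction.toAlgHom ℂ (Op n L) (ConjAct.toConjAct W))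
    (Matrix.mulVecLin W) (fun X ψ => ?_) hΩ
  change ((W : Op n L) * X * (↑W⁻¹ : Op n L)) *ᵥ ((W : Op n L) *ᵥ ψ) = (W : Op n L) *ᵥ (X *ᵥ ψ)
  rw [Matrix.mulVec_mulVec, Units.inv_mul_cancel_right, Matrix.mulVec_mulVec]

theorem isBAE_conj_iff (W : (Op n L)ˣ) :
    IsBAE (fun u => (W : Op n L) * t u * (↑W⁻¹ : Op n L)) ((W : Op n L) *ᵥ Ω) E ↔
      IsBAE t Ω E := by
  refine ⟨fun h => ?_, fun h => h.conj W⟩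
  simpa only [inv_inv, mul_assoc, Units.inv_mul, mul_one, Units.inv_mul_cancel_left,
    Matrix.mulVec_mulVec, Matrix.one_mulVec] using h.conj W⁻¹

end Transport

end OpenChain

theorem mainTheorem1_general (n L : ℕ)
    (D : Set (OpenChain.BoundaryData n))
    (g : OpenChain.BoundaryData n → OpenChain.BoundaryData n)
    (hgD : ∀ b ∈ D, g b ∈ D) (hg : ∀ b ∈ D, g (g b) = b)
    (U : OpenChain.BoundaryData n → (OpenChain.Op n L)ˣ)
    (ω ω' : OpenChain.State n L)
    (hU : ∀ b ∈ D, ∀ u : ℂ,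
      (U b : OpenChain.Op n L) * OpenChain.transfer L b u * (↑(U b)⁻¹ : OpenChain.Op n L) =
        OpenChain.transfer L (g b) u)
    (hω : ∀ b ∈ D, (U b : OpenChain.Op n L) *ᵥ ω = ω') :
    ∀ b ∈ D,
      (∀ E : (M : Fin (n - 1) → ℕ) → OpenChain.Roots n M → Prop,
        OpenChain.IsBAE (OpenChain.transfer L b) ω' E ↔
          OpenChain.IsBAE (OpenChain.transfer L (g b)) ω E) ∧
      (ω = OpenChain.pseudovacuum n L 1 →
        OpenChain.IsBAE (OpenChain.transfer L b) ω'
          fun _ v => (OpenChain.standardAnsatz L (g b)).SolvesBAE v) := by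
  intro b hb
  have transfer_eq : OpenChain.transfer L b = fun u =>
      (U (g b) : OpenChain.Op n L) * OpenChain.transfer L (g b) u *
        (↑(U (g b))⁻¹ : OpenChain.Op n L) := by
    funext u
    rw [hU (g b) (hgD b hb), hg b hb]
  have isBAE_iff (E : (M : Fin (n - 1) → ℕ) → OpenChain.Roots n M → Prop) :
      OpenChain.IsBAE (OpenChain.transfer L b) ω' E ↔
        OpenChain.IsBAE (OpenChain.transfer L (g b)) ω E := by
    rw [transfer_eq, ← hω (g b) (hgD b hb)]
    exact OpenChain.isBAE_conj_iff (U (g b))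
  refine ⟨isBAE_iff, ?_⟩
  rintro rfl
  exact (isBAE_iff _).2 (OpenChain.standardAnsatz L (g b)).isBAE

theorem mainTheorem1 (n L : ℕ)
    (D : Set (OpenChain.BoundaryData n))
    (g : OpenChain.BoundaryData n → OpenChain.BoundaryData n)
    (hgD : ∀ b ∈ D, g b ∈ D) (hg : ∀ b ∈ D, g (g b) = b)
    (U : OpenChain.BoundaryData n → Matrix.unitaryGroup (Fin L → Fin n) ℂ)
    (ω ω' : OpenChain.State n L)
    (hU : ∀ b ∈ D, ∀ u : ℂ,
      (U b : OpenChain.Op n L) * OpenChain.transfer L b u * (U b : OpenChain.Op n L)ᴴ =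
        OpenChain.transfer L (g b) u)
    (hω : ∀ b ∈ D, (U b : OpenChain.Op n L) *ᵥ ω = ω') :
    ∀ b ∈ D,
      (∀ E : (M : Fin (n - 1) → ℕ) → OpenChain.Roots n M → Prop,
        OpenChain.IsBAE (OpenChain.transfer L b) ω' E ↔
          OpenChain.IsBAE (OpenChain.transfer L (g b)) ω E) ∧
      (ω = OpenChain.pseudovacuum n L 1 →
        OpenChain.IsBAE (OpenChain.transfer L b) ω'
          fun _ v => (OpenChain.standardAnsatz L (g b)).SolvesBAE v) :=
  mainTheorem1_general n L D g hgD hg (fun b => Unitary.toUnits (U b)) ω ω' hU hω
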